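/- Let $s$ be a natural number with $n = 2^s \ge 4$, and let $\mathrm{Tr}$ denote the trace map from $\mathbb{F}_{2^n}$ to $\mathbb{F}_2$. An element $\alpha \in \mathbb{F}_{2^n}$ is called normal over $\mathbb{F}_2$ if $\alpha, \alpha^2, \alpha^{2^2}, \dots, \alpha^{2^{n-1}}$ is a basis of $\mathbb{F}_{2^n}$ over $\mathbb{F}_2$. Its corresponding vector is $(\mathrm{Tr}(\alpha^{1+2^i}))_{0\le i\le n-1} \in \mathbb{F}_2^n$. Let $(a_0, a_1, \dots, a_{n-1}) \in \mathbb{F}_2^n$. Then there exists a normal element of $\mathbb{F}_{2^n}$ over $\mathbb{F}_2$ whose corresponding vector is $(a_0, a_1, \dots, a_{n-1})$ if and only if the following three conditions hold: 1. $a_0 = 1$ and $a_{n/2} = 0$; 2. $a_i = a_{n-i}$ for all $1 \le i \le n/2 - 1$; 3. $\displaystyle\sum_{1 \le i \le n/2-1,\ i \text{ odd}} a_i = 1$ in $\mathbb{F}_2$. -/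

import Mathlib

/-- `α` is a normal element of `K` over the finite field `F` with `q` elements, where `K` has
degree `n` over `F`: the family `α, α ^ q, …, α ^ (q ^ (n - 1))` is a basis of `K` over `F`. -/
def IsNormalElement (F : Type*) {K : Type*} [Field F] [Field K] [Algebra F K]
    (n : ℕ) (α : K) : Prop :=
  LinearIndependent F (fun i : Fin n => α ^ (Nat.card F ^ (i : ℕ))) ∧
    Submodule.span F (Set.range (fun i : Fin n => α ^ (Nat.card F ^ (i : ℕ)))) = ⊤

/-- The corresponding vector (trace self-orthogonal relation) `(a_0, …, a_{n-1})` of `α`,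
where `a_i = Tr (α * α ^ (q ^ i))` and `q` is the number of elements of `F`. -/
noncomputable def correspondingVector (F : Type*) {K : Type*} [Field F] [Field K] [Algebra F K]
    (n : ℕ) (α : K) : Fin n → F :=
  fun i => Algebra.trace F K (α * α ^ (Nat.card F ^ (i : ℕ)))

/-! Let `R` be the group ring over 𝔽₂ of the cyclic group of order `n`, with generator `x`,
inversion `*`, and `w = x + x⁻¹`, nilpotent because `n` is a power of two. Encode a vector as `∑ aᵢ
xⁱ`; the three conditions make it `1 + w + w² h` with `h = h*`. Corresponding vectors become values
`gram n α α` of a form that is sesquilinear over `R`, where `x` acts on `K` by squaring.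

Necessity is trace computation; condition 3 says that the trace of `α` to 𝔽₄ has norm 1
(`sum_trace_mul_pow_odd`). For sufficiency, take any `γ` of trace one. Its Gram value and the target
are both of the above form, so they differ by a factor `f f*` (`exists_mul_map_mul_eq`, an
Artin–Schreier equation). Letting `f` act on `γ` realises the target, and normality follows since
the Gram value is a unit. -/

open Polynomial Finset

/-! ### Norms of symmetric elements in characteristic two -/

section SymmetricElements

variable {R : Type*} [CommRing R] [CharP R 2] {τ : R →+* R} {x y : R}

/-- In characteristic two, `z = q + q ^ 2` is solvable for nilpotent `z`, and `q` can be chosen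
fixed by any ring endomorphism fixing `z`. -/
theorem exists_add_sq_eq_of_isNilpotent {z : R} (hz : IsNilpotent z) (hτ : τ z = z) :
    ∃ q, τ q = q ∧ q + q ^ 2 = z := by
  obtain ⟨m, hm⟩ := hz
  -- Squaring shifts this sum by one index, so `q + q ^ 2` telescopes.
  refine ⟨∑ j ∈ range m, z ^ 2 ^ j, by simp [hτ], ?_⟩
  have hm' : z ^ 2 ^ m = 0 := pow_eq_zero_of_le m.lt_two_pow_self.le hm
  rw [CharTwo.sum_sq, ← CharTwo.sub_eq_add, ← Finset.sum_sub_distrib]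
  have h := Finset.sum_range_sub' (fun j => z ^ 2 ^ j) m
  simpa [← pow_mul, ← pow_succ, hm'] using h

/-- The power sum `x ^ i + y ^ i` of two inverse elements is congruent to `i * (x + y)` modulo
`(x + y) ^ 2` times symmetric elements. -/
theorem exists_pow_add_pow_eq (hxy : x * y = 1) (hx : τ x = y) (hy : τ y = x) (i : ℕ) :
    ∃ h, τ h = h ∧ x ^ i + y ^ i = i * (x + y) + (x + y) ^ 2 * h := by
  induction i using Nat.twoStepInduction with
  | zero => exact ⟨0, by simp, by simp [CharTwo.add_self_eq_zero]⟩
  | one => exact ⟨0, by simp, by simp⟩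
  | more i h₁ h₂ =>
    obtain ⟨h, hh, e⟩ := h₁
    obtain ⟨h', hh', e'⟩ := h₂
    refine ⟨(i + 1 : ℕ) + (x + y) * h' - h, by simp [hx, hy, hh, hh', add_comm], ?_⟩
    have h2 : (2 : R) = 0 := CharTwo.two_eq_zero
    have key : x ^ (i + 2) + y ^ (i + 2)
        = (x + y) * (x ^ (i + 1) + y ^ (i + 1)) - (x ^ i + y ^ i) := by
      linear_combination (-(x ^ i + y ^ i)) * hxy
    rw [key, e, e']
    push_cast
    linear_combination (-(i + 1) * (x + y)) * h2

theorem exists_sum_smul_pow_add_pow_eq [Algebra (ZMod 2) R] (hxy : x * y = 1) (hx : τ x = y)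
    (hy : τ y = x) (a : ℕ → ZMod 2) (s : Finset ℕ) :
    ∃ h, τ h = h ∧ ∑ i ∈ s, algebraMap (ZMod 2) R (a i) * (x ^ i + y ^ i) =
      algebraMap (ZMod 2) R (∑ i ∈ s, a i * i) * (x + y) + (x + y) ^ 2 * h := by
  choose h hh e using exists_pow_add_pow_eq hxy hx hy
  have hτ : ∀ c : ZMod 2, τ (algebraMap (ZMod 2) R c) = algebraMap (ZMod 2) R c := fun c =>
    RingHom.congr_fun (Subsingleton.elim (τ.comp (algebraMap (ZMod 2) R)) _) c
  refine ⟨∑ i ∈ s, algebraMap (ZMod 2) R (a i) * h i, by simp [hτ, hh], ?_⟩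
  rw [map_sum, Finset.sum_mul, Finset.mul_sum, ← Finset.sum_add_distrib]
  refine Finset.sum_congr rfl fun i _ => ?_
  rw [e, map_mul, map_natCast]
  ring

/-- Symmetric elements congruent to `1 + (x + y)` modulo `(x + y) ^ 2` differ by a norm. -/
theorem exists_mul_map_mul_eq (hxy : x * y = 1) (hx : τ x = y) (hy : τ y = x)
    (hw : IsNilpotent (x + y)) {g h : R} (hg : τ g = g) (hh : τ h = h) :
    ∃ f, f * τ f * (1 + (x + y) + (x + y) ^ 2 * h) = 1 + (x + y) + (x + y) ^ 2 * g := by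
  have hτw : τ (x + y) = x + y := by rw [map_add, hx, hy, add_comm]
  have hu : IsUnit (1 + (x + y) + (x + y) ^ 2 * h) := by
    have := IsNilpotent.isUnit_one_add
      ((Commute.all (x + y) (1 + (x + y) * h)).isNilpotent_mul_right hw)
    convert this using 1
    ring
  obtain ⟨c, hc⟩ := hu.exists_right_inv
  have hτc : τ c = c := by
    have h1 := congrArg τ hc
    simp only [map_mul, map_add, map_one, map_pow, hx, hy, hh] at h1
    rw [add_comm y x] at h1
    exact hu.mul_left_cancel (h1.trans hc.symm)
  obtain ⟨q, hq, e⟩ := exists_add_sq_eq_of_isNilpotent (τ := τ)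
    (z := (x + y) * ((g - h) * c)) ((Commute.all _ _).isNilpotent_mul_right hw)
    (by rw [map_mul, map_mul, map_sub, hτw, hg, hh, hτc])
  -- As `(1 + x)(1 + y) = x + y` here, this has norm `1 + (x + y)(q + q ^ 2)`.
  refine ⟨1 + q * (1 + x), ?_⟩
  have h2 : (2 : R) = 0 := CharTwo.two_eq_zero
  have hn : (1 + q * (1 + x)) * τ (1 + q * (1 + x)) = 1 + (x + y) * ((x + y) * ((g - h) * c)) := by
    simp only [map_mul, map_add, map_one, hx, hq]
    linear_combination (x + y) * e + q ^ 2 * hxy + (q + q ^ 2) * h2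
  rw [hn]
  linear_combination ((x + y) ^ 2 * (g - h)) * hc

end SymmetricElements

/-! ### The group ring of the cyclic group -/

section CyclicRing

variable {n : ℕ}

/-- The group ring over `𝔽₂` of the cyclic group of order `n`, as `𝔽₂[X] / (X ^ n - 1)`. -/
abbrev CyclicRing (n : ℕ) : Type := AdjoinRoot (X ^ n - 1 : (ZMod 2)[X])

namespace CyclicRing

/-- The class of `X`, a generator of the cyclic group. -/
noncomputable abbrev gen (n : ℕ) : CyclicRing n := AdjoinRoot.root _

theorem gen_pow_self (n : ℕ) : gen n ^ n = 1 := by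
  have h := AdjoinRoot.eval₂_root (X ^ n - 1 : (ZMod 2)[X])
  simpa [sub_eq_zero] using h

theorem gen_mul_pow_pred (hn : 0 < n) : gen n * gen n ^ (n - 1) = 1 := by
  rw [← pow_succ', Nat.sub_add_cancel hn, gen_pow_self]

/-- The involution of the group ring inverting the group elements. -/
noncomputable def inversion (n : ℕ) : CyclicRing n →+* CyclicRing n :=
  AdjoinRoot.lift (AdjoinRoot.of _) (gen n ^ (n - 1)) (by
    simp [← pow_mul, mul_comm (n - 1) n, pow_mul (gen n) n, gen_pow_self])

theorem inversion_gen (n : ℕ) : inversion n (gen n) = gen n ^ (n - 1) := by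
  simp [inversion]

theorem inversion_of (c : ZMod 2) :
    inversion n (AdjoinRoot.of _ c) = AdjoinRoot.of _ c := by
  simp [inversion]

theorem inversion_gen_pow_pred (hn : 0 < n) : inversion n (gen n ^ (n - 1)) = gen n := by
  have h := congrArg (inversion n) (gen_mul_pow_pred hn)
  rw [map_mul, map_one, inversion_gen] at h
  calc _ = gen n * gen n ^ (n - 1) * inversion n (gen n ^ (n - 1)) := by
        rw [gen_mul_pow_pred hn, one_mul]
    _ = gen n := by rw [mul_assoc, h, mul_one]

theorem nontrivial_of_pos (hn : 0 < n) : Nontrivial (CyclicRing n) := by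
  apply AdjoinRoot.nontrivial
  rw [← C_1, degree_X_pow_sub_C hn]
  exact_mod_cast hn.ne'

theorem charP_two (hn : 0 < n) : CharP (CyclicRing n) 2 :=
  have := nontrivial_of_pos hn
  charP_of_injective_algebraMap (algebraMap (ZMod 2) (CyclicRing n)).injective 2

/-- By Frobenius the `n / 2`-th power is `x ^ (n / 2) + x ^ (-n / 2)`, and `x ^ (n / 2)` is its own
inverse. -/
theorem isNilpotent_gen_add {s : ℕ} (hn : n = 2 ^ (s + 1)) :
    IsNilpotent (gen n + gen n ^ (n - 1)) := by
  have hpos : 0 < n := by rw [hn]; positivity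
  have := charP_two hpos
  refine ⟨2 ^ s, ?_⟩
  have h2 : 2 ^ s + 2 ^ s = n := by rw [hn]; ring
  have hinv : gen n ^ 2 ^ s * (gen n ^ (n - 1)) ^ 2 ^ s = 1 := by
    rw [← mul_pow, gen_mul_pow_pred hpos, one_pow]
  have hself : gen n ^ 2 ^ s * gen n ^ 2 ^ s = 1 := by rw [← pow_add, h2, gen_pow_self]
  have h : (gen n ^ (n - 1)) ^ 2 ^ s = gen n ^ 2 ^ s := by
    calc _ = gen n ^ 2 ^ s * gen n ^ 2 ^ s * (gen n ^ (n - 1)) ^ 2 ^ s := by rw [hself, one_mul]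
      _ = _ := by rw [mul_assoc, hinv, mul_one]
  rw [add_pow_char_pow, h, CharTwo.add_self_eq_zero]

/-- The powers of the generator below `n` are linearly independent. -/
theorem eq_of_sum_of_mul_gen_pow_eq (hn : 0 < n) {a b : ℕ → ZMod 2}
    (h : ∑ i ∈ range n, AdjoinRoot.of _ (a i) * gen n ^ i =
      ∑ i ∈ range n, AdjoinRoot.of _ (b i) * gen n ^ i) {i : ℕ} (hi : i < n) : a i = b i := by
  have hd : (X ^ n - 1 : (ZMod 2)[X]).degree = n := by rw [← C_1, degree_X_pow_sub_C hn]
  have hz : AdjoinRoot.mk (X ^ n - 1 : (ZMod 2)[X])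
      (∑ i ∈ range n, C (a i - b i) * X ^ i) = 0 := by
    rw [← sub_eq_zero, ← Finset.sum_sub_distrib] at h
    simpa [sub_mul] using h
  rw [AdjoinRoot.mk_eq_zero] at hz
  have h0 := eq_zero_of_dvd_of_degree_lt hz (by
    rw [hd]
    refine (degree_sum_le _ _).trans_lt ?_
    rw [Finset.sup_lt_iff (by exact_mod_cast WithBot.bot_lt_coe n)]
    intro i hi
    refine (degree_C_mul_X_pow_le _ _).trans_lt ?_
    exact_mod_cast Finset.mem_range.mp hi)
  have := congrArg (fun p => coeff p i) h0
  simp only [finsetSum_coeff, coeff_C_mul_X_pow, coeff_zero, Finset.sum_ite_eq,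
    Finset.mem_range, if_pos hi] at this
  exact sub_eq_zero.mp this

/-- A vector `a` with `a 0 = 1`, `a (n / 2) = 0`, which is symmetric, and whose entries at the odd
places below `n / 2` sum to `1`, gives an element congruent to `1 + (x + x⁻¹)` modulo
`(x + x⁻¹) ^ 2`. -/
theorem exists_sum_of_mul_gen_pow_eq {m : ℕ} (hm : 0 < m) (hn : n = 2 * m) {a : ℕ → ZMod 2}
    (h0 : a 0 = 1) (hmid : a m = 0) (hsymm : ∀ i, 1 ≤ i → i < m → a i = a (n - i))
    (hsum : ∑ i ∈ range m, a i * i = 1) :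
    ∃ h, inversion n h = h ∧ ∑ i ∈ range n, AdjoinRoot.of _ (a i) * gen n ^ i =
      1 + (gen n + gen n ^ (n - 1)) + (gen n + gen n ^ (n - 1)) ^ 2 * h := by
  have hpos : 0 < n := by omega
  have := charP_two hpos
  obtain ⟨h, hh, e⟩ := exists_sum_smul_pow_add_pow_eq (gen_mul_pow_pred hpos) (inversion_gen n)
    (inversion_gen_pow_pred hpos) a (Finset.Ico 1 m)
  refine ⟨h, hh, ?_⟩
  have hsum' : ∑ i ∈ Finset.Ico 1 m, a i * i = 1 := by
    rw [← hsum, Finset.range_eq_Ico, Finset.sum_eq_sum_Ico_succ_bot hm]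
    simp
  rw [hsum', map_one, one_mul] at e
  rw [add_assoc, ← e]
  simp only [mul_add, Finset.sum_add_distrib]
  have hrefl : ∑ i ∈ Finset.Ico 1 m, algebraMap (ZMod 2) (CyclicRing n) (a i) *
        (gen n ^ (n - 1)) ^ i =
      ∑ i ∈ Finset.Ico (m + 1) n, AdjoinRoot.of _ (a i) * gen n ^ i := by
    refine Finset.sum_bij' (fun i _ => n - i) (fun i _ => n - i) ?_ ?_ ?_ ?_ ?_
    · intro i hi; simp only [Finset.mem_Ico] at *; omega
    · intro i hi; simp only [Finset.mem_Ico] at *; omega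
    · intro i hi; simp only [Finset.mem_Ico] at *; omega
    · intro i hi; simp only [Finset.mem_Ico] at *; omega
    · intro i hi
      simp only [Finset.mem_Ico] at hi
      rw [← hsymm i hi.1 hi.2]
      congr 1
      have h1 : gen n ^ (n - i) * gen n ^ i = 1 := by
        rw [← pow_add, Nat.sub_add_cancel (by omega), gen_pow_self]
      have h2 : gen n ^ i * (gen n ^ (n - 1)) ^ i = 1 := by
        rw [← mul_pow, gen_mul_pow_pred hpos, one_pow]
      linear_combination (-(gen n ^ (n - 1)) ^ i) * h1 + gen n ^ (n - i) * h2
  rw [hrefl, Finset.range_eq_Ico, ← Finset.sum_Ico_consecutive _ (Nat.zero_le m) (by omega : m ≤ n),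
    Finset.sum_eq_sum_Ico_succ_bot hm, Finset.sum_eq_sum_Ico_succ_bot (by omega : m < n)]
  simp [h0, hmid, add_assoc]

end CyclicRing

end CyclicRing

theorem sum_range_two_mul_eq_add {M : Type*} [AddCommMonoid M] (f : ℕ → M) (m : ℕ) :
    ∑ i ∈ range (2 * m), f i = ∑ j ∈ range m, f (2 * j) + ∑ j ∈ range m, f (2 * j + 1) := by
  induction m with
  | zero => simp
  | succ m ih =>
    rw [mul_add, mul_one, Finset.sum_range_succ, Finset.sum_range_succ, ih, Finset.sum_range_succ,
      Finset.sum_range_succ]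
    abel

theorem finite_of_card_eq_two_pow {n : ℕ} {K : Type*} (hK : Nat.card K = 2 ^ n) : Finite K :=
  Nat.finite_of_card_ne_zero (by rw [hK]; positivity)

theorem pow_two_pow_of_card_eq {n : ℕ} {K : Type*} [Field K] (hK : Nat.card K = 2 ^ n) (a : K) : a ^ 2 ^ n = a := by
  have := finite_of_card_eq_two_pow hK
  rw [← hK]
  have := Fintype.ofFinite K
  rw [Nat.card_eq_fintype_card, FiniteField.pow_card]

theorem mul_pow_two_pow_reflect {n : ℕ} {K : Type*} [Field K] (hK : Nat.card K = 2 ^ n) (a : K)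
    {i j : ℕ} (hij : i + j = n) :
    (a * a ^ 2 ^ i) ^ 2 ^ j = a * a ^ 2 ^ j := by
  rw [mul_pow, ← pow_mul a, ← pow_add 2, hij, pow_two_pow_of_card_eq hK, mul_comm]

/-! ### Traces of `a ^ (1 + 2 ^ i)` -/

section Trace

variable {n : ℕ} {K : Type*} [Field K] [Algebra (ZMod 2) K]

theorem charP_two_of_algebra_zmod (K : Type*) [Field K] [Algebra (ZMod 2) K] : CharP K 2 :=
  charP_of_injective_algebraMap (algebraMap (ZMod 2) K).injective 2

theorem finrank_of_card_eq_two_pow (hK : Nat.card K = 2 ^ n) : Module.finrank (ZMod 2) K = n := by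
  have := finite_of_card_eq_two_pow hK
  have h := Module.natCard_eq_pow_finrank (K := ZMod 2) (V := K)
  rw [hK, Nat.card_zmod] at h
  exact (Nat.pow_right_injective le_rfl h).symm

theorem algebraMap_trace_eq_sum_pow_two_pow (hK : Nat.card K = 2 ^ n) (a : K) :
    algebraMap (ZMod 2) K (Algebra.trace (ZMod 2) K a) = ∑ i ∈ range n, a ^ 2 ^ i := by
  have := finite_of_card_eq_two_pow hK
  rw [FiniteField.algebraMap_trace_eq_sum_pow, finrank_of_card_eq_two_pow hK, Nat.card_zmod]

theorem trace_sq (hK : Nat.card K = 2 ^ n) (a : K) :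
    Algebra.trace (ZMod 2) K (a ^ 2) = Algebra.trace (ZMod 2) K a := by
  apply (algebraMap (ZMod 2) K).injective
  simp only [algebraMap_trace_eq_sum_pow_two_pow hK, ← pow_mul, ← pow_succ']
  have h1 := Finset.sum_range_succ (fun i => a ^ 2 ^ i) n
  rw [Finset.sum_range_succ', pow_two_pow_of_card_eq hK] at h1
  simpa using h1

theorem trace_pow_two_pow (hK : Nat.card K = 2 ^ n) (a : K) (k : ℕ) :
    Algebra.trace (ZMod 2) K (a ^ 2 ^ k) = Algebra.trace (ZMod 2) K a := by
  induction k with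
  | zero => simp
  | succ k ih => rw [pow_succ, pow_mul, trace_sq hK, ih]

theorem exists_trace_eq_one (hK : Nat.card K = 2 ^ n) :
    ∃ a : K, Algebra.trace (ZMod 2) K a = 1 :=
  have := finite_of_card_eq_two_pow hK
  Algebra.trace_surjective (ZMod 2) K 1

/-- The trace of `a ^ (1 + 2 ^ i)` is invariant under `i ↦ n - i`. -/
theorem trace_mul_pow_symm (hK : Nat.card K = 2 ^ n) (a : K) {i : ℕ} (hi : i ≤ n) :
    Algebra.trace (ZMod 2) K (a * a ^ 2 ^ i) = Algebra.trace (ZMod 2) K (a * a ^ 2 ^ (n - i)) := by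
  rw [← trace_pow_two_pow hK (a * a ^ 2 ^ i) (n - i), mul_pow_two_pow_reflect hK a (by omega)]

theorem trace_mul_self (hK : Nat.card K = 2 ^ n) (a : K) :
    Algebra.trace (ZMod 2) K (a * a ^ 2 ^ 0) = Algebra.trace (ZMod 2) K a := by
  rw [pow_zero, pow_one, ← sq, trace_sq hK]

theorem trace_mul_pow_half {m : ℕ} (hn : n = 2 * m) (hK : Nat.card K = 2 ^ n) (a : K) :
    Algebra.trace (ZMod 2) K (a * a ^ 2 ^ m) = 0 := by
  have := charP_two_of_algebra_zmod K
  apply (algebraMap (ZMod 2) K).injective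
  rw [algebraMap_trace_eq_sum_pow_two_pow hK, hn, two_mul, Finset.sum_range_add, map_zero]
  -- The element lies in the subfield of index two, so the conjugates repeat and cancel in pairs.
  have : ∀ i, (a * a ^ 2 ^ m) ^ 2 ^ (m + i) = (a * a ^ 2 ^ m) ^ 2 ^ i := by
    intro i
    rw [pow_add, pow_mul (a * a ^ 2 ^ m)]
    rw [mul_pow_two_pow_reflect hK a (by omega)]
  simp only [this, CharTwo.add_self_eq_zero]

/-- For `4 ∣ n` and `a` of absolute trace one, the traces of `a ^ (1 + 2 ^ i)` at the odd places
`i < n / 2` sum to the norm to `𝔽₂` of the trace of `a` to `𝔽₄`, which is `1`. -/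
theorem sum_trace_mul_pow_odd {l : ℕ} (hn : n = 4 * l) (hK : Nat.card K = 2 ^ n) {a : K}
    (ha : Algebra.trace (ZMod 2) K a = 1) :
    ∑ k ∈ range l, Algebra.trace (ZMod 2) K (a * a ^ 2 ^ (2 * k + 1)) = 1 := by
  have := charP_two_of_algebra_zmod K
  -- `E` is the relative trace to 𝔽₄.
  set E : K → K := fun b => ∑ j ∈ range (2 * l), b ^ 2 ^ (2 * j) with hE
  have hE2 : ∀ b, E b ^ 2 = ∑ j ∈ range (2 * l), b ^ 2 ^ (2 * j + 1) := fun b => by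
    simp only [hE, CharTwo.sum_sq, ← pow_mul, ← pow_succ]
  have hE4 : ∀ b, E b ^ 4 = E b := fun b => by
    have h1 := Finset.sum_range_succ (fun j => b ^ 2 ^ (2 * j)) (2 * l)
    rw [Finset.sum_range_succ', show 2 * (2 * l) = n by omega, pow_two_pow_of_card_eq hK] at h1
    have h2 : E b ^ 4 = ∑ j ∈ range (2 * l), b ^ 2 ^ (2 * (j + 1)) := by
      rw [show E b ^ 4 = (E b ^ 2) ^ 2 by ring, hE2, CharTwo.sum_sq]
      simp only [← pow_mul, ← pow_succ]
      rfl
    rw [h2]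
    simpa using h1
  have hT : ∀ b, algebraMap (ZMod 2) K (Algebra.trace (ZMod 2) K b) = E b + E b ^ 2 := fun b => by
    rw [algebraMap_trace_eq_sum_pow_two_pow hK, hE2, hE, show n = 2 * (2 * l) by omega,
      sum_range_two_mul_eq_add]
  have hpow : ∀ b k, E b ^ 2 ^ (2 * k) = E b := fun b k => by
    induction k with
    | zero => simp
    | succ k ih => rw [mul_add, pow_add, pow_mul, ih]; exact hE4 b
  have hEpow : ∀ b k, E (b ^ 2 ^ k) = E b ^ 2 ^ k := fun b k => by
    simp only [hE, sum_pow_char_pow, ← pow_mul, mul_comm]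
  have hprod : E a * E a ^ 2 = ∑ k ∈ range (2 * l), E (a * a ^ 2 ^ (2 * k + 1)) := by
    have h1 : ∀ j, E a ^ 2 = ∑ k ∈ range (2 * l), (a ^ 2 ^ (2 * k + 1)) ^ 2 ^ (2 * j) := fun j => by
      rw [← sum_pow_char_pow, ← hE2, ← pow_mul, mul_comm, pow_mul, hpow]
    simp only [hE]
    rw [Finset.sum_comm, Finset.sum_mul]
    refine Finset.sum_congr rfl fun j _ => ?_
    simp only [mul_pow]
    rw [← Finset.mul_sum, ← h1 j]
  -- The two odd exponents add up to `n`, so the terms are conjugate over 𝔽₂ and sum to an absolute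
  -- trace.
  have hpair : ∀ k < l, E (a * a ^ 2 ^ (2 * (2 * l - 1 - k) + 1)) =
      E (a * a ^ 2 ^ (2 * k + 1)) ^ 2 := fun k hk => by
    rw [← mul_pow_two_pow_reflect hK a
      (show 2 * (2 * l - 1 - k) + 1 + (2 * k + 1) = n by omega), hEpow, pow_succ 2 (2 * k),
      pow_mul, hpow, ← pow_mul]
    exact (hE4 _).symm
  have hsum : ∑ k ∈ range (2 * l), E (a * a ^ 2 ^ (2 * k + 1)) =
      ∑ k ∈ range l, (E (a * a ^ 2 ^ (2 * k + 1)) + E (a * a ^ 2 ^ (2 * k + 1)) ^ 2) := by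
    rw [Finset.sum_add_distrib, two_mul, Finset.sum_range_add]
    congr 1
    rw [← Finset.sum_range_reflect]
    refine Finset.sum_congr rfl fun k hk => ?_
    have hk := Finset.mem_range.mp hk
    rw [← hpair k hk, show l + (l - 1 - k) = 2 * l - 1 - k by omega]
  apply (algebraMap (ZMod 2) K).injective
  rw [map_sum, map_one]
  simp only [hT]
  rw [← hsum, ← hprod]
  have h1 := hT a
  rw [ha, map_one] at h1
  have h0 : E a ≠ 0 := fun h => by simp [h] at h1
  apply mul_left_cancel₀ h0
  linear_combination hE4 a

end Trace

/-! ### The group-ring-valued trace form -/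

section Gram

open CyclicRing

variable {n : ℕ} {K : Type*} [Field K] [Algebra (ZMod 2) K]

/-- The pairing `∑ Tr(α β ^ (2 ^ i)) x ^ i` on `K` with values in the group ring of the cyclic
group of order `n`. Its diagonal values encode the corresponding vectors. -/
noncomputable def gram (n : ℕ) (α β : K) : CyclicRing n :=
  ∑ i ∈ range n, AdjoinRoot.of _ (Algebra.trace (ZMod 2) K (α * β ^ 2 ^ i)) * gen n ^ i

theorem gram_add_left (α α' β : K) : gram n (α + α') β = gram n α β + gram n α' β := by
  simp only [gram, add_mul, map_add, Finset.sum_add_distrib]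

theorem gram_add_right (α β β' : K) : gram n α (β + β') = gram n α β + gram n α β' := by
  have := charP_two_of_algebra_zmod K
  simp only [gram, add_pow_char_pow, mul_add, add_mul, map_add, Finset.sum_add_distrib]

theorem gram_smul_left (c : ZMod 2) (α β : K) :
    gram n (c • α) β = AdjoinRoot.of _ c * gram n α β := by
  simp only [gram, smul_mul_assoc, map_smul, smul_eq_mul, map_mul, Finset.mul_sum, mul_assoc]

theorem gram_smul_right (c : ZMod 2) (α β : K) :
    gram n α (c • β) = AdjoinRoot.of _ c * gram n α β := by
  simp only [gram, _root_.smul_pow, ZMod.pow_card_pow, mul_smul_comm, map_smul, smul_eq_mul, map_mul,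
    Finset.mul_sum, mul_assoc]

theorem sum_range_shift_of_eq {M : Type*} [AddCommGroup M] {f : ℕ → M} (h : f n = f 0) :
    ∑ i ∈ range n, f (i + 1) = ∑ i ∈ range n, f i := by
  have h1 := Finset.sum_range_succ f n
  rw [Finset.sum_range_succ', h] at h1
  exact add_right_cancel h1

theorem gram_sq_left (hK : Nat.card K = 2 ^ n) (α β : K) :
    gram n (α ^ 2) β = gen n * gram n α β := by
  unfold gram
  rw [← sum_range_shift_of_eq (by simp [pow_two_pow_of_card_eq hK, gen_pow_self]), Finset.mul_sum]
  refine Finset.sum_congr rfl fun i _ => ?_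
  rw [pow_succ 2 i, pow_mul, ← mul_pow, trace_sq hK]
  ring

theorem gram_sq_right (hn : 0 < n) (hK : Nat.card K = 2 ^ n) (α β : K) :
    gram n α (β ^ 2) = gen n ^ (n - 1) * gram n α β := by
  have h : gen n * gram n α (β ^ 2) = gram n α β := by
    unfold gram
    rw [← sum_range_shift_of_eq (f := fun i =>
      AdjoinRoot.of _ (Algebra.trace (ZMod 2) K (α * β ^ 2 ^ i)) * gen n ^ i)
      (by simp [pow_two_pow_of_card_eq hK, gen_pow_self]), Finset.mul_sum]
    refine Finset.sum_congr rfl fun i _ => ?_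
    rw [pow_succ' 2 i, pow_mul]
    ring
  rw [← h, ← mul_assoc, mul_comm _ (gen n), gen_mul_pow_pred hn, one_mul]

/-- The squaring map of `K` as an endomorphism over `𝔽₂`. -/
noncomputable abbrev squaring (K : Type*) [Field K] [Algebra (ZMod 2) K] :
    Module.End (ZMod 2) K :=
  (FiniteField.frobeniusAlgHom (ZMod 2) K).toLinearMap

theorem squaring_apply (α : K) : squaring K α = α ^ 2 := by
  simp [squaring]

theorem squaring_pow_apply (α : K) (k : ℕ) : (squaring K ^ k) α = α ^ 2 ^ k := by
  induction k with
  | zero => simp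
  | succ k ih => rw [pow_succ', Module.End.mul_apply, ih, squaring_apply, ← pow_mul, ← pow_succ]

theorem gram_aeval_left (hK : Nat.card K = 2 ^ n) (p : (ZMod 2)[X]) (α β : K) :
    gram n (aeval (squaring K) p α) β = AdjoinRoot.mk _ p * gram n α β := by
  induction p using Polynomial.induction_on with
  | C c => simp [Module.algebraMap_end_apply, gram_smul_left]
  | add p q hp hq => simp only [map_add, LinearMap.add_apply, gram_add_left, hp, hq, add_mul]
  | monomial k c h =>
    rw [show (C c * X ^ (k + 1) : (ZMod 2)[X]) = X * (C c * X ^ k) by ring, map_mul, aeval_X,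
      Module.End.mul_apply, squaring_apply, gram_sq_left hK, h, map_mul (AdjoinRoot.mk _) X,
      AdjoinRoot.mk_X, mul_assoc]

theorem gram_aeval_right (hn : 0 < n) (hK : Nat.card K = 2 ^ n) (p : (ZMod 2)[X]) (α β : K) :
    gram n α (aeval (squaring K) p β) = inversion n (AdjoinRoot.mk _ p) * gram n α β := by
  induction p using Polynomial.induction_on with
  | C c => simp [Module.algebraMap_end_apply, gram_smul_right, inversion_of]
  | add p q hp hq => simp only [map_add, LinearMap.add_apply, gram_add_right, hp, hq, add_mul]
  | monomial k c h =>
    rw [show (C c * X ^ (k + 1) : (ZMod 2)[X]) = X * (C c * X ^ k) by ring, map_mul, aeval_X,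
      Module.End.mul_apply, squaring_apply, gram_sq_right hn hK, h,
      map_mul (AdjoinRoot.mk _) X, AdjoinRoot.mk_X, map_mul (inversion n) (gen n), inversion_gen, mul_assoc]

/-- A relation among the conjugates is a polynomial in Frobenius killing `α`; its class annihilates
the unit Gram value, hence vanishes. -/
theorem isNormalElement_of_isUnit_gram (hn : 0 < n) (hK : Nat.card K = 2 ^ n) {α : K}
    (h : IsUnit (gram n α α)) : IsNormalElement (ZMod 2) n α := by
  have := finite_of_card_eq_two_pow hK
  have : Nonempty (Fin n) := ⟨⟨0, hn⟩⟩
  have hli : LinearIndependent (ZMod 2) (fun i : Fin n => α ^ (Nat.card (ZMod 2) ^ (i : ℕ))) := by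
    rw [Fintype.linearIndependent_iff]
    intro c hc i
    simp only [Nat.card_zmod] at hc
    set c' : ℕ → ZMod 2 := fun i => if h : i < n then c ⟨i, h⟩ else 0 with hc'
    have hc0 : ∑ i ∈ range n, c' i • α ^ 2 ^ i = 0 := by
      rw [← hc, Finset.sum_range]
      simp [hc']
    have hp : aeval (squaring K) (∑ i ∈ range n, C (c' i) * X ^ i : (ZMod 2)[X]) α = 0 := by
      rw [← hc0]
      simp [LinearMap.sum_apply, Module.algebraMap_end_apply, squaring_pow_apply]
    have hg := gram_aeval_left hK (∑ i ∈ range n, C (c' i) * X ^ i : (ZMod 2)[X]) α α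
    rw [hp, show gram n 0 α = 0 by simp [gram], eq_comm, h.mul_left_eq_zero] at hg
    have hci : c' i = 0 := eq_of_sum_of_mul_gen_pow_eq (b := fun _ => 0) hn (by simpa using hg) i.2
    simpa [hc'] using hci
  exact ⟨hli, hli.span_eq_top_of_card_eq_finrank'
    (by rw [Fintype.card_fin, finrank_of_card_eq_two_pow hK])⟩

theorem IsNormalElement.trace_eq_one (hn : 0 < n) (hK : Nat.card K = 2 ^ n) {α : K}
    (h : IsNormalElement (ZMod 2) n α) : Algebra.trace (ZMod 2) K α = 1 := by
  have hne : Algebra.trace (ZMod 2) K α ≠ 0 := fun h0 => by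
    -- Trace zero would be a linear relation with all coefficients 1.
    have h1 := algebraMap_trace_eq_sum_pow_two_pow hK α
    rw [h0, map_zero, Finset.sum_range] at h1
    have := Fintype.linearIndependent_iff.mp h.1 (fun _ => 1) (by simpa using h1.symm) ⟨0, hn⟩
    exact one_ne_zero this
  exact Fin.eq_one_of_ne_zero _ hne

end Gram

/-- The sum of the entries at odd places below `n / 2`. -/
theorem sum_filter_coprime_two_eq {M : Type*} [AddCommMonoid M] {n l : ℕ} (hn : n = 4 * l)
    (a : Fin n → M) (b : ℕ → M) (hab : ∀ i : Fin n, a i = b i) :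
    ∑ i ∈ Finset.univ.filter
        (fun i : Fin n => 1 ≤ (i : ℕ) ∧ (i : ℕ) ≤ n / 2 - 1 ∧ Nat.Coprime (i : ℕ) 2), a i =
      ∑ k ∈ range l, b (2 * k + 1) := by
  refine Finset.sum_bij' (fun i _ => (i : ℕ) / 2)
    (fun k hk => ⟨2 * k + 1, by have := Finset.mem_range.mp hk; omega⟩) ?_ ?_ ?_ ?_ ?_
  all_goals
    simp only [Finset.mem_filter, Finset.mem_univ, true_and, Finset.mem_range,
      Nat.coprime_two_right, Nat.odd_iff]
  · intro i hi; omega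
  · intro k hk; omega
  · intro i hi; ext; simp only; omega
  · intro k hk; omega
  · intro i hi; rw [hab]; congr 1; omega

theorem mainTheorem1 (n s : ℕ) (hns : n = 2 ^ s) (hn : 4 ≤ n)
    (K : Type*) [Field K] [Algebra (ZMod 2) K] (hK : Nat.card K = 2 ^ n)
    (a : Fin n → ZMod 2) :
    (∃ α : K, IsNormalElement (ZMod 2) n α ∧ correspondingVector (ZMod 2) n α = a) ↔
      (a ⟨0, by omega⟩ = 1 ∧ a ⟨n / 2, by omega⟩ = 0) ∧
      (∀ i j : Fin n, 1 ≤ (i : ℕ) → (i : ℕ) ≤ n / 2 - 1 → (j : ℕ) = n - (i : ℕ) → a i = a j) ∧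
      (∑ i ∈ Finset.univ.filter
        (fun i : Fin n => 1 ≤ (i : ℕ) ∧ (i : ℕ) ≤ n / 2 - 1 ∧ Nat.Coprime (i : ℕ) 2), a i) = 1 := by
  obtain ⟨t, rfl⟩ : ∃ t, s = t + 2 := by
    refine ⟨s - 2, ?_⟩
    have : ¬ s < 2 := fun h => by
      have : s = 0 ∨ s = 1 := by omega
      rcases this with rfl | rfl <;> norm_num at hns <;> omega
    omega
  have hpos : 0 < n := by omega
  have hl : n = 4 * 2 ^ t := by rw [hns]; ring
  have hm : n = 2 * (2 * 2 ^ t) := by rw [hns]; ring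
  have hhalf : n / 2 = 2 * 2 ^ t := by omega
  have htr : ∀ γ : K, Algebra.trace (ZMod 2) K γ = 1 →
      ∑ k ∈ range (2 ^ t), Algebra.trace (ZMod 2) K (γ * γ ^ 2 ^ (2 * k + 1)) = 1 :=
    fun γ hγ => sum_trace_mul_pow_odd hl hK hγ
  -- Modulo 2 the weight `i` selects the odd places; this sum is the coefficient of `w`.
  have hodd : ∀ b : ℕ → ZMod 2, ∑ i ∈ range (2 * 2 ^ t), b i * i =
      ∑ k ∈ range (2 ^ t), b (2 * k + 1) := fun b => by
    have h2 : (2 : ZMod 2) = 0 := rfl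
    simp [sum_range_two_mul_eq_add, h2]
  constructor
  · rintro ⟨α, hα, rfl⟩
    have h1 := hα.trace_eq_one hpos hK
    have hv : ∀ i : Fin n, correspondingVector (ZMod 2) n α i =
        Algebra.trace (ZMod 2) K (α * α ^ 2 ^ (i : ℕ)) := fun i => by
      rw [correspondingVector, Nat.card_zmod]
    refine ⟨⟨?_, ?_⟩, ?_, ?_⟩
    · rw [hv, trace_mul_self hK, h1]
    · rw [hv]
      exact trace_mul_pow_half (by simp only; omega) hK α
    · intro i j _ _ hij
      rw [hv, hv, hij, trace_mul_pow_symm hK α i.2.le]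
    · rw [sum_filter_coprime_two_eq hl _
        (fun i => Algebra.trace (ZMod 2) K (α * α ^ 2 ^ i)) hv, htr α h1]
  · rintro ⟨⟨h0, hmid⟩, hsymm, hsum⟩
    set b : ℕ → ZMod 2 := fun i => if h : i < n then a ⟨i, h⟩ else 0 with hb
    have hba : ∀ i (h : i < n), b i = a ⟨i, h⟩ := fun i h => by simp [hb, h]
    have := CyclicRing.charP_two hpos
    have hnil := CyclicRing.isNilpotent_gen_add (s := t + 1) hns
    obtain ⟨g, hg, eg⟩ := CyclicRing.exists_sum_of_mul_gen_pow_eq (a := b) (by positivity) hm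
      (by rw [hba 0 hpos, h0]) (by rw [hba _ (by omega), ← hmid]; simp [hhalf])
      (fun i hi hi' => by
        rw [hba i (by omega), hba (n - i) (by omega)]
        exact hsymm _ _ hi (by simp only; omega) rfl)
      (by rw [hodd, ← hsum, sum_filter_coprime_two_eq hl a b fun i => (hba i i.2).symm])
    obtain ⟨γ, hγ⟩ := exists_trace_eq_one hK
    obtain ⟨h, hh, eh⟩ := CyclicRing.exists_sum_of_mul_gen_pow_eq
      (a := fun i => Algebra.trace (ZMod 2) K (γ * γ ^ 2 ^ i)) (by positivity) hm
      (by rw [trace_mul_self hK, hγ]) (trace_mul_pow_half hm hK γ)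
      (fun i _ _ => trace_mul_pow_symm hK γ (by omega)) (by rw [hodd, htr γ hγ])
    obtain ⟨f, hf⟩ := exists_mul_map_mul_eq (CyclicRing.gen_mul_pow_pred hpos)
      (CyclicRing.inversion_gen n) (CyclicRing.inversion_gen_pow_pred hpos) hnil hg hh
    -- A polynomial lift of `f` can be evaluated at Frobenius and applied to `γ`.
    obtain ⟨p, rfl⟩ := AdjoinRoot.mk_surjective f
    have hgram : gram n (aeval (squaring K) p γ) (aeval (squaring K) p γ) =
        ∑ i ∈ range n, AdjoinRoot.of _ (b i) * CyclicRing.gen n ^ i := by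
      rw [gram_aeval_left hK, gram_aeval_right hpos hK, ← mul_assoc, eg, ← hf, ← eh, gram]
    refine ⟨aeval (squaring K) p γ, isNormalElement_of_isUnit_gram hpos hK ?_, ?_⟩
    · rw [hgram, eg, show ∀ w : CyclicRing n, 1 + w + w ^ 2 * g = 1 + w * (1 + w * g) by
        intro w; ring]
      exact ((Commute.all _ _).isNilpotent_mul_right hnil).isUnit_one_add
    · ext i
      rw [correspondingVector, Nat.card_zmod]
      exact (CyclicRing.eq_of_sum_of_mul_gen_pow_eq hpos hgram i.2).trans (hba i i.2)
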